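/- Let $p$ be a prime, let $R$ be a $p$-adically complete and separated commutative ring, and let $\mathcal{H}$ be a $p$-divisible group over $\operatorname{Spf} R$. Put $$\mathcal{O}(\mathcal{H})=\varprojlim_n \mathcal{O}(\mathcal{H}[p^n]),$$ with the inverse limit of the $p$-adic topologies, and let $\mathcal{O}(T_p\mathcal{H}^\vee)$ be the $p$-adic completion of $\varinjlim_n\mathcal{O}(\mathcal{H}[p^n]^D)$, where $\mathcal{H}[p^n]^D$ is the Cartier dual, so that $T_p\mathcal{H}^\vee=\varprojlim_n \mathcal{H}[p^n]^D=\operatorname{Hom}(\mathcal{H},\mathbb{G}_m)$. Write $(-)^*$ for continuous $R$-linear duals. Let $\kappa\in\mathcal{O}(\mathcal{H})\,\widehat\otimes_R\,\mathcal{O}(T_p\mathcal{H}^\vee)$ be the universal character, i.e. the canonical pairing $\mathcal{H}\times T_p\mathcal{H}^\vee\to\mathbb{G}_m\subset\mathbb{A}^1$ viewed as a function, and let $$\mathbb{F}^{\mathcal{H}}:\mathcal{O}(\mathcal{H})^*\to\mathcal{O}(T_p\mathcal{H}^\vee),\quad \mu\mapsto(\mu\,\widehat\otimes\,\mathrm{id})(\kappa),\qquad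 \mathbb{F}_{\mathcal{H}}:\mathcal{O}(T_p\mathcal{H}^\vee)^*\to\mathcal{O}(\mathcal{H}),\quad \nu\mapsto(\mathrm{id}\,\widehat\otimes\,\nu)(\kappa)$$ be the integral Fourier transforms. Let $\operatorname{Lie}\mathcal{H}$ be the $R$-module of continuous $R$-linear derivations $\mathcal{O}(\mathcal{H})\to R$ at the origin, and let $\operatorname{Sym}^\bullet\operatorname{Lie}\mathcal{H}$ act as follows. 1. On $\mathcal{O}(\mathcal{H})$ it acts by invariant differential operators: the action extends the action of $\operatorname{Lie}\mathcal{H}$ by differentiation along invariant vector fields, $D\mapsto(\mathrm{id}\,\widehat\otimes\,D)\circ\Delta$ with $\Delta$ the comultiplication. 2. On $\mathcal{O}(\mathcal{H})^*$ it acts by the dual action $(s\cdot\mu)(a)=\mu(s\cdot a)$. 3. On $\mathcal{O}(T_p\mathcal{H}^\vee)$ an element $s\in\operatorname{Sym}^\bullet\operatorname{Lie}\mathcal{H}=\mathcal{O}(\omega_{\mathcal{H}})$ acts by multiplication by $\mathrm{HT}^*(s)$, where $\mathrm{HT}:T_p\mathcal{H}^\vee\to\omega_{\mathcal{H}}$,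 $f\mapsto f^*\frac{dt}{1+t}$, is the Hodge--Tate map (with $1+t$ the coordinate on $\mathbb{G}_m$). 4. On $\mathcal{O}(T_p\mathcal{H}^\vee)^*$ it acts by the dual action $(s\cdot\nu)(b)=\nu(\mathrm{HT}^*(s)\,b)$. Then $\mathbb{F}^{\mathcal{H}}$ and $\mathbb{F}_{\mathcal{H}}$ are equivariant for these actions: for all $s\in\operatorname{Sym}^\bullet\operatorname{Lie}\mathcal{H}$, $\mu\in\mathcal{O}(\mathcal{H})^*$ and $\nu\in\mathcal{O}(T_p\mathcal{H}^\vee)^*$, $$\mathbb{F}^{\mathcal{H}}(s\cdot\mu)=\mathrm{HT}^*(s)\,\mathbb{F}^{\mathcal{H}}(\mu)\qquad\text{and}\qquad \mathbb{F}_{\mathcal{H}}(s\cdot\nu)=s\cdot\mathbb{F}_{\mathcal{H}}(\nu).$$ -/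

import Mathlib

open TensorProduct

universe u v

noncomputable section

/-- The topological ring `R` is `p`-adically complete and separated, with the `p`-adic topology. -/
class IsPAdicRing (p : ℕ) (R : Type u) [CommRing R] [TopologicalSpace R] : Prop where
  isAdic : IsAdic (Ideal.span {(p : R)})
  isAdicComplete : IsAdicComplete (Ideal.span {(p : R)}) R

namespace FiniteGroupScheme

variable (R : Type u) [CommRing R] (A : Type v) [CommRing A] [HopfAlgebra R A]

/-- The augmentation ideal of `A = 𝒪(G)`, i.e. the ideal of the unit section of `G`. -/
def augIdeal : Ideal A := RingHom.ker (Bialgebra.counitAlgHom R A)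

/-- `[m]^* : 𝒪(G) → 𝒪(G)`, pullback along multiplication by `m` on `G`: the `m`-th power of the
identity for the group law `(f, g) ↦ mult ∘ (f ⊗ g) ∘ comult` on algebra maps. -/
def mulBy [Coalgebra.IsCocomm R A] (m : ℕ) : A →ₐ[R] A :=
  (WithConv.toConv (AlgHom.id R A) ^ m).ofConv

end FiniteGroupScheme

/-- A `p`-divisible group over `R`, i.e. a system of finite locally free commutative group
schemes `H[p^n] = Spec (A n)` with closed immersions `H[p^m] → H[p^n]` for `m ≤ n` identifying
`H[p^m]` with the kernel of `p^m` on `H[p^n]`, and such that multiplication by `p` on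
`H[p^(n+1)]` factors through a faithfully flat homomorphism `H[p^(n+1)] → H[p^n]`. -/
structure PDivisibleGroup (p : ℕ) (R : Type u) [CommRing R] where
  /-- `A n = 𝒪(H[p^n])` -/
  A : ℕ → Type v
  [commRing : ∀ n, CommRing (A n)]
  [hopfAlgebra : ∀ n, HopfAlgebra R (A n)]
  [isCocomm : ∀ n, Coalgebra.IsCocomm R (A n)]
  [finite : ∀ n, Module.Finite R (A n)]
  [projective : ∀ n, Module.Projective R (A n)]
  /-- restriction of functions from `H[p^n]` to `H[p^m]` -/
  res : ∀ {m n : ℕ}, m ≤ n → (A n →ₐc[R] A m)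
  res_self : ∀ (n : ℕ) (a : A n), res le_rfl a = a
  res_res : ∀ {l m n : ℕ} (h : l ≤ m) (h' : m ≤ n) (a : A n),
    res h (res h' a) = res (h.trans h') a
  res_surjective : ∀ {m n : ℕ} (h : m ≤ n), Function.Surjective (res h)
  ker_res : ∀ {m n : ℕ} (h : m ≤ n),
    RingHom.ker (res h) = (FiniteGroupScheme.augIdeal R (A n)).map
      (FiniteGroupScheme.mulBy R (A n) (p ^ m))
  /-- pullback of functions along the homomorphism `H[p^(n+1)] → H[p^n]` induced by `p` -/
  quot : ∀ n : ℕ, A n →ₐc[R] A (n + 1)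
  quot_res : ∀ (n : ℕ) (a : A (n + 1)),
    quot n (res n.le_succ a) = FiniteGroupScheme.mulBy R (A (n + 1)) p a
  quot_faithfullyFlat : ∀ n : ℕ, ((quot n : A n →ₐ[R] A (n + 1)) : A n →+* A (n + 1)).FaithfullyFlat

namespace PDivisibleGroup

attribute [instance] commRing hopfAlgebra isCocomm finite projective

variable {p : ℕ} {R : Type u} [CommRing R] (H : PDivisibleGroup.{u, v} p R)

/-! ### Functions on `H` -/

/-- `𝒪(H) = lim_n 𝒪(H[p^n])` as a subalgebra of the product. -/
def funSubalgebra : Subalgebra R (∀ n, H.A n) where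
  carrier := {a | ∀ (m n : ℕ) (h : m ≤ n), H.res h (a n) = a m}
  mul_mem' ha hb m n h := by simp [ha m n h, hb m n h]
  add_mem' ha hb m n h := by simp [ha m n h, hb m n h]
  algebraMap_mem' r m n h := AlgHomClass.commutes (H.res h) r

/-- `𝒪(H)`, the topological ring of functions on `H`. -/
def Fun : Type v := H.funSubalgebra

instance : CommRing H.Fun := inferInstanceAs (CommRing H.funSubalgebra)
instance : Algebra R H.Fun := inferInstanceAs (Algebra R H.funSubalgebra)

/-- restriction of functions from `H` to `H[p^n]` -/
def proj (n : ℕ) : H.Fun →ₐ[R] H.A n :=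
  (Pi.evalAlgHom R H.A n).comp H.funSubalgebra.val

@[ext] theorem Fun.ext {a b : H.Fun} (h : ∀ n, H.proj n a = H.proj n b) : a = b :=
  Subtype.ext (funext h)

theorem res_proj {m n : ℕ} (h : m ≤ n) (a : H.Fun) : H.res h (H.proj n a) = H.proj m a :=
  a.2 m n h

theorem proj_surjective (n : ℕ) : Function.Surjective (H.proj n) := by
  intro x
  choose s hs using fun k => H.res_surjective (Nat.le_succ k)
  let y : ∀ j, H.A (n + j) := fun j => Nat.rec (motive := fun j => H.A (n + j)) x
    (fun j z => s (n + j) z) j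
  have hy : ∀ j, H.res (Nat.le_succ (n + j)) (y (j + 1)) = y j := fun j => hs _ _
  have hy' : ∀ i j (h : n + i ≤ n + j), H.res h (y j) = y i := by
    intro i j h
    obtain ⟨k, rfl⟩ := Nat.exists_eq_add_of_le (Nat.le_of_add_le_add_left h)
    clear_value y
    induction k with
    | zero => exact H.res_self _ _
    | succ k ih =>
      have := ih (by omega)
      rw [← this, ← hy (i + k)]
      exact (H.res_res _ _ _).symm
  refine ⟨⟨fun m => H.res (Nat.le_add_left m n) (y m), ?_⟩, ?_⟩
  · intro m k h
    change H.res h (H.res _ (y k)) = H.res _ (y m)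
    rw [H.res_res, ← hy' m k (by omega), H.res_res]
  · change H.res (Nat.le_add_left n n) (y n) = x
    exact hy' 0 n (by omega)

/-- The topology of `𝒪(H)`: the inverse limit of the `p`-adic topologies of the `𝒪(H[p^n])`. -/
instance : TopologicalSpace H.Fun :=
  ⨅ n, TopologicalSpace.induced (H.proj n) (Ideal.span {(p : H.A n)}).adicTopology

/-- Every neighbourhood of `0` in `𝒪(H)` contains some `{a | a|_{H[p^n]} ∈ p^k 𝒪(H[p^n])}`. -/
theorem mem_nhds_zero (s : Set H.Fun) : s ∈ nhds (0 : H.Fun) ↔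
    ∃ n k : ℕ, {a | H.proj n a ∈ Ideal.span {(p : H.A n)} ^ k} ⊆ s := by
  have hb : ∀ n, (@nhds H.Fun (TopologicalSpace.induced (H.proj n)
      (Ideal.span {(p : H.A n)}).adicTopology) 0).HasBasis (fun _ : ℕ => True)
      (fun k => {a | H.proj n a ∈ Ideal.span {(p : H.A n)} ^ k}) := by
    intro n
    rw [@nhds_induced _ _ (Ideal.span {(p : H.A n)}).adicTopology, map_zero]
    exact ((Ideal.span {(p : H.A n)}).hasBasis_nhds_zero_adic).comap _
  have hd : Directed (· ≥ ·) (fun n => @nhds H.Fun (TopologicalSpace.induced (H.proj n)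
      (Ideal.span {(p : H.A n)}).adicTopology) 0) := by
    refine (antitone_nat_of_succ_le fun n => ?_).directed_ge
    refine ((hb (n + 1)).le_basis_iff (hb n)).2 fun k _ => ⟨k, trivial, fun a ha => ?_⟩
    have := Ideal.mem_map_of_mem (H.res (Nat.le_succ n)) ha
    rw [Ideal.map_pow, Ideal.map_span, H.res_proj] at this
    simpa using this
  change s ∈ @nhds H.Fun (⨅ n, _) 0 ↔ _
  rw [nhds_iInf, Filter.mem_iInf_of_directed hd]
  simp [(hb _).mem_iff]

instance : IsTopologicalAddGroup H.Fun := by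
  refine topologicalAddGroup_iInf fun n => ?_
  let _ := (Ideal.span {(p : H.A n)}).adicTopology
  have : IsTopologicalRing (H.A n) := (Ideal.span {(p : H.A n)}).ringFilterBasis.isTopologicalRing
  exact topologicalAddGroup_induced (H.proj n)

/-- An `R`-linear map out of `𝒪(H)` is continuous as soon as the preimages of the neighbourhoods of
`0` are open. -/
theorem continuous_of_nhds_zero {M : Type*} [AddCommGroup M] [TopologicalSpace M]
    [IsTopologicalAddGroup M] [Module R M] (f : H.Fun →ₗ[R] M)
    (h : ∀ s ∈ nhds (0 : M), ∃ n k : ℕ,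
      ∀ a, H.proj n a ∈ Ideal.span {(p : H.A n)} ^ k → f a ∈ s) : Continuous f := by
  refine continuous_of_continuousAt_zero f ?_
  intro s hs
  rw [map_zero] at hs
  obtain ⟨n, k, hnk⟩ := h s hs
  exact (H.mem_nhds_zero _).2 ⟨n, k, hnk⟩

instance : ContinuousConstSMul R H.Fun where
  continuous_const_smul r := by
    refine H.continuous_of_nhds_zero (LinearMap.lsmul R H.Fun r) fun s hs => ?_
    obtain ⟨n, k, h⟩ := (H.mem_nhds_zero s).1 hs
    refine ⟨n, k, fun a ha => h ?_⟩
    have : H.proj n (r • a) = r • H.proj n a := map_smul _ _ _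
    change H.proj n (r • a) ∈ Ideal.span {(p : H.A n)} ^ k
    rw [this]
    exact Submodule.smul_of_tower_mem _ r ha

/-! ### Distributions on `H` -/

variable [TopologicalSpace R]

/-- `𝒪(H)^*`, the continuous `R`-linear dual of `𝒪(H)`. -/
abbrev Dist : Type (max u v) := H.Fun →L[R] R

/-- The ideal `(p)` of `R`. -/
abbrev ideal (p : ℕ) (R : Type u) [CommRing R] : Ideal R := Ideal.span {(p : R)}

theorem mem_span_pow_iff {p : ℕ} {R : Type u} [CommRing R] {S : Type*} [CommRing S] [Algebra R S]
    (k : ℕ) (x : S) :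
    x ∈ Ideal.span {(p : S)} ^ k ↔ x ∈ (ideal p R ^ k • ⊤ : Submodule R S) := by
  rw [Ideal.smul_top_eq_map, Ideal.map_pow, Ideal.map_span]
  simp

variable {H} in
/-- `f : 𝒪(H[p^m]) → R` agrees with the distribution `μ` modulo `p^k`. -/
def Approx (μ : H.Dist) (k m : ℕ) (f : H.A m →ₗ[R] R) : Prop :=
  ∀ a : H.Fun, μ a - f (H.proj m a) ∈ ideal p R ^ k

variable {H} in
theorem exists_approx [IsPAdicRing p R] (μ : H.Dist) (k : ℕ) : ∃ m f, Approx μ k m f := by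
  have hU : ((ideal p R ^ k : Ideal R) : Set R) ∈ nhds (0 : R) :=
    (IsPAdicRing.isAdic.hasBasis_nhds_zero).mem_of_mem trivial
  have h2 := μ.continuous.continuousAt (x := 0)
  rw [ContinuousAt, map_zero] at h2
  obtain ⟨m, j, h⟩ := (H.mem_nhds_zero _).1 (h2 hU)
  obtain ⟨s, hs⟩ := Module.projective_lifting_property (H.proj m).toLinearMap LinearMap.id
    (H.proj_surjective m)
  refine ⟨m, μ.toLinearMap ∘ₗ s, fun a => ?_⟩
  have h3 : a - s (H.proj m a) ∈ {a | H.proj m a ∈ Ideal.span {(p : H.A m)} ^ j} := by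
    have : H.proj m (s (H.proj m a)) = H.proj m a := LinearMap.congr_fun hs (H.proj m a)
    simp [this]
  have h4 := h h3
  simpa using h4

variable {H} in
theorem Approx.res {μ : H.Dist} {k m n : ℕ} {f : H.A m →ₗ[R] R} (hf : Approx μ k m f)
    (h : m ≤ n) : Approx μ k n (f ∘ₗ (H.res h : H.A n →ₗ[R] H.A m)) := by
  intro a
  have := hf a
  rw [← H.res_proj h] at this
  exact this

variable {H} in
theorem Approx.mono {μ : H.Dist} {k l m : ℕ} {f : H.A m →ₗ[R] R} (hf : Approx μ k m f)
    (h : l ≤ k) : Approx μ l m f := fun a => Ideal.pow_le_pow_right h (hf a)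

variable {H} in
theorem Approx.sub_mem {μ : H.Dist} {k m : ℕ} {f g : H.A m →ₗ[R] R} (hf : Approx μ k m f)
    (hg : Approx μ k m g) (x : H.A m) : f x - g x ∈ ideal p R ^ k := by
  obtain ⟨a, rfl⟩ := H.proj_surjective m x
  have := Ideal.sub_mem _ (hg a) (hf a)
  simpa using this

/-! ### Integration of families of functions -/

section Slice

variable {R : Type u} [CommRing R] {A : Type v} [AddCommGroup A] [Module R A]
variable (C : Type*) [CommRing C] [Algebra R C]

/-- `id ⊗ f : C ⊗ A → C` for a linear form `f` on `A`. -/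
def slice (f : A →ₗ[R] R) : C ⊗[R] A →ₗ[C] C :=
  (AlgebraTensorModule.rid R C C).toLinearMap ∘ₗ f.baseChange C

@[simp] theorem slice_tmul (f : A →ₗ[R] R) (c : C) (a : A) : slice C f (c ⊗ₜ a) = f a • c := by
  simp [slice]

theorem slice_mem (f : A →ₗ[R] R) (J : Ideal R) (hf : ∀ a, f a ∈ J) (x : C ⊗[R] A) :
    slice C f x ∈ (J • ⊤ : Submodule R C) := by
  induction x with
  | zero => simp
  | tmul c a => rw [slice_tmul]; exact Submodule.smul_mem_smul (hf a) trivial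
  | add x y hx hy => rw [map_add]; exact add_mem hx hy

theorem slice_sub (f g : A →ₗ[R] R) (x : C ⊗[R] A) :
    slice C (f - g) x = slice C f x - slice C g x := by
  simp [slice, LinearMap.baseChange_sub]

theorem slice_comp {A' : Type*} [AddCommGroup A'] [Module R A'] (f : A →ₗ[R] R)
    (g : A' →ₗ[R] A) (x : C ⊗[R] A') :
    slice C (f ∘ₗ g) x = slice C f (g.lTensor C x) := by
  induction x with
  | zero => simp
  | tmul c a => simp
  | add x y hx hy => simp [hx, hy]

theorem slice_map {C' : Type*} [CommRing C'] [Algebra R C'] (φ : C →ₗ[R] C') (f : A →ₗ[R] R)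
    (x : C ⊗[R] A) : slice C' f (φ.rTensor A x) = φ (slice C f x) := by
  induction x with
  | zero => simp
  | tmul c a => simp
  | add x y hx hy => simp [hx, hy]

end Slice
section Families

variable {p : ℕ} {R : Type u} [CommRing R] (H : PDivisibleGroup.{u, v} p R)
variable (C : Type*) [CommRing C] [Algebra R C]

/-- Restriction `C ⊗ 𝒪(H[p^n]) → C ⊗ 𝒪(H[p^m])`. -/
abbrev resTensor {m n : ℕ} (h : m ≤ n) : C ⊗[R] H.A n →ₐ[C] C ⊗[R] H.A m :=
  Algebra.TensorProduct.map (AlgHom.id C C) (H.res h : H.A n →ₐ[R] H.A m)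

/-- `lim_n C ⊗ 𝒪(H[p^n])`, the completed tensor product of `C` and `𝒪(H)` for a `p`-adically
complete `R`-algebra `C`; these are the functions on the base change of `H` to `C`. -/
def family : Subalgebra C (∀ n, C ⊗[R] H.A n) where
  carrier := {x | ∀ (m n : ℕ) (h : m ≤ n), H.resTensor C h (x n) = x m}
  mul_mem' hx hy m n h := by
    rw [Pi.mul_apply, Pi.mul_apply, map_mul, hx m n h, hy m n h]
  add_mem' hx hy m n h := by
    rw [Pi.add_apply, Pi.add_apply, map_add, hx m n h, hy m n h]
  algebraMap_mem' c m n h := AlgHomClass.commutes (H.resTensor C h) c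

variable {C} in
theorem slice_res {m n : ℕ} (h : m ≤ n) (f : H.A m →ₗ[R] R) (x : H.family C) :
    slice C (f ∘ₗ (H.res h : H.A n →ₗ[R] H.A m)) (x.1 n) = slice C f (x.1 m) := by
  rw [slice_comp, ← x.2 m n h]
  rfl

variable {H}
variable [TopologicalSpace R] [IsPAdicRing p R]

theorem existsUnique_integral [hC : IsAdicComplete (ideal p R) C] (μ : H.Dist) (x : H.family C) :
    ∃! c : C, ∀ (k m : ℕ) (f : H.A m →ₗ[R] R), Approx μ k m f →
      slice C f (x.1 m) - c ∈ (ideal p R ^ k • ⊤ : Submodule R C) := by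
  choose m f hf using fun k => exists_approx μ k
  have key : ∀ k n n' (g : H.A n →ₗ[R] R) (g' : H.A n' →ₗ[R] R), Approx μ k n g →
      Approx μ k n' g' →
      slice C g (x.1 n) - slice C g' (x.1 n') ∈ (ideal p R ^ k • ⊤ : Submodule R C) := by
    intro k n n' g g' hg hg'
    rw [← H.slice_res (le_max_left n n') g, ← H.slice_res (le_max_right n n') g', ← slice_sub]
    exact slice_mem C _ _ (fun a => (hg.res (le_max_left n n')).sub_mem
      (hg'.res (le_max_right n n')) a) _
  obtain ⟨c, hc⟩ := hC.toIsPrecomplete.prec' (fun k => slice C (f k) (x.1 (m k))) (by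
    intro k l h
    rw [SModEq.sub_mem]
    exact key k _ _ _ _ (hf k) ((hf l).mono h))
  refine ⟨c, fun k n g hg => ?_, fun c' hc' => ?_⟩
  · have := add_mem (key k _ _ _ _ hg (hf k)) (SModEq.sub_mem.1 (hc k))
    simpa using this
  · rw [← sub_eq_zero]
    refine hC.toIsHausdorff.haus' _ fun k => ?_
    rw [SModEq.zero]
    have := sub_mem (SModEq.sub_mem.1 (hc k)) (hc' k _ _ (hf k))
    simpa using this

/-- Integration `μ ⊗̂ id : 𝒪(H) ⊗̂ C → C` against a distribution `μ` on `H`. It is the unique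
element which, for all `k`, is congruent modulo `p^k` to what one obtains by applying to the
component in `C ⊗ 𝒪(H[p^m])` any linear form on `𝒪(H[p^m])` which agrees with `μ` modulo `p^k`. -/
def integral [IsAdicComplete (ideal p R) C] (μ : H.Dist) : H.family C →ₗ[C] C where
  toFun x := (existsUnique_integral C μ x).choose
  map_add' x y := by
    refine ((existsUnique_integral C μ (x + y)).choose_spec.2 _ fun k m f hf => ?_).symm
    have := add_mem ((existsUnique_integral C μ x).choose_spec.1 k m f hf)
      ((existsUnique_integral C μ y).choose_spec.1 k m f hf)
    have e : slice C f ((x + y : H.family C).1 m) = slice C f (x.1 m) + slice C f (y.1 m) :=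
      map_add _ _ _
    rw [e]
    convert this using 1
    ring
  map_smul' c x := by
    refine ((existsUnique_integral C μ (c • x)).choose_spec.2 _ fun k m f hf => ?_).symm
    have := (existsUnique_integral C μ x).choose_spec.1 k m f hf
    have e : slice C f ((c • x : H.family C).1 m) = c • slice C f (x.1 m) :=
      (slice C f).map_smul c (x.1 m)
    rw [e, RingHom.id_apply, ← smul_sub]
    rw [← mem_span_pow_iff] at this ⊢
    exact Ideal.mul_mem_left _ c this

theorem integral_spec [IsAdicComplete (ideal p R) C] (μ : H.Dist) (x : H.family C) {k m : ℕ}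
    {f : H.A m →ₗ[R] R} (hf : Approx μ k m f) :
    slice C f (x.1 m) - integral C μ x ∈ (ideal p R ^ k • ⊤ : Submodule R C) :=
  (existsUnique_integral C μ x).choose_spec.1 k m f hf

theorem integral_unique [IsAdicComplete (ideal p R) C] (μ : H.Dist) (x : H.family C) (c : C)
    (h : ∀ (k m : ℕ) (f : H.A m →ₗ[R] R), Approx μ k m f →
      slice C f (x.1 m) - c ∈ (ideal p R ^ k • ⊤ : Submodule R C)) : integral C μ x = c :=
  ((existsUnique_integral C μ x).choose_spec.2 c h).symm

end Families
/-! ### Invariant differential operators -/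

theorem map_smul_top_mem {R : Type*} [CommRing R] {M N : Type*} [AddCommGroup M] [Module R M] [AddCommGroup N] [Module R N]
    (J : Ideal R) (f : M →ₗ[R] N) {x : M} (hx : x ∈ (J • ⊤ : Submodule R M)) :
    f x ∈ (J • ⊤ : Submodule R N) := by
  have := Submodule.mem_map_of_mem (f := f) hx
  rw [Submodule.map_smul''] at this
  exact Submodule.smul_mono le_rfl le_top this

theorem isAdicComplete_of_finite_projective {R : Type*} [CommRing R] (I : Ideal R)
    [hR : IsAdicComplete I R] (M : Type*) [AddCommGroup M] [Module R M] [Module.Finite R M]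
    [Module.Projective R M] : IsAdicComplete I M := by
  obtain ⟨n, f, g, -, -, hfg⟩ := Module.Finite.exists_comp_eq_id_of_projective R M
  have hfg' : ∀ x, f (g x) = x := fun x => LinearMap.congr_fun hfg x
  have hmap : ∀ (k : ℕ) (x : M), x ∈ (I ^ k • ⊤ : Submodule R M) → ∀ i, g x i ∈ I ^ k := by
    intro k x hx i
    have h2 := map_smul_top_mem (I ^ k) (LinearMap.proj i ∘ₗ g) hx
    simpa using h2
  have hback : ∀ (k : ℕ) (y : Fin n → R), (∀ i, y i ∈ I ^ k) →
      f y ∈ (I ^ k • ⊤ : Submodule R M) := by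
    intro k y hy
    rw [pi_eq_sum_univ' y, map_sum]
    refine sum_mem fun i _ => ?_
    rw [map_smul]
    exact Submodule.smul_mem_smul (hy i) trivial
  refine { haus' := fun x hx => ?_, prec' := fun s hs => ?_ }
  · have : g x = 0 := by
      ext i
      refine hR.toIsHausdorff.haus' _ fun k => ?_
      rw [SModEq.zero]
      simpa using hmap k x (SModEq.zero.1 (hx k)) i
    rw [← hfg' x, this, map_zero]
  · have : ∀ i, ∃ L : R, ∀ k, g (s k) i ≡ L [SMOD (I ^ k • ⊤ : Submodule R R)] := by
      intro i
      refine hR.toIsPrecomplete.prec' _ fun {k l} h => ?_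
      have := hmap k _ (SModEq.sub_mem.1 (hs h)) i
      rw [SModEq.sub_mem]
      simpa using this
    choose L hL using this
    refine ⟨f L, fun k => ?_⟩
    rw [SModEq.sub_mem]
    have := hback k (g (s k) - L) fun i => by simpa using SModEq.sub_mem.1 (hL i k)
    rwa [map_sub, hfg'] at this

section Operators

variable {p : ℕ} {R : Type u} [CommRing R] (H : PDivisibleGroup.{u, v} p R)

/-- Pullback `𝒪(H) → 𝒪(H[p^n] × H[p^m])` along the addition `H[p^n] × H[p^m] → H`. -/
def comulAt (n m : ℕ) : H.Fun →ₗ[R] H.A n ⊗[R] H.A m :=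
  TensorProduct.map (H.res (le_max_left n m) : H.A (max n m) →ₗ[R] H.A n)
    (H.res (le_max_right n m) : H.A (max n m) →ₗ[R] H.A m) ∘ₗ Coalgebra.comul ∘ₗ
    (H.proj (max n m)).toLinearMap

theorem comulAt_eq {n m N : ℕ} (hn : n ≤ N) (hm : m ≤ N) (a : H.Fun) :
    H.comulAt n m a = TensorProduct.map (H.res hn : H.A N →ₗ[R] H.A n)
      (H.res hm : H.A N →ₗ[R] H.A m) (Coalgebra.comul (R := R) (H.proj N a)) := by
  have h : max n m ≤ N := max_le hn hm
  have e := CoalgHomClass.map_comp_comul_apply (H.res h) (H.proj N a)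
  simp only [comulAt, LinearMap.comp_apply, AlgHom.toLinearMap_apply]
  rw [← H.res_proj h, ← e, ← LinearMap.comp_apply, ← TensorProduct.map_comp]
  congr 2 <;> ext b <;> exact H.res_res _ _ _

/-- Pullback `𝒪(H) → 𝒪(H[p^n]) ⊗̂ 𝒪(H)` along the addition `H[p^n] × H → H`. -/
def coaction (n : ℕ) : H.Fun →ₗ[R] H.family (H.A n) where
  toFun a := ⟨fun m => H.comulAt n m a, fun m m' h => by
    beta_reduce
    rw [H.comulAt_eq (le_max_left n m') (h.trans (le_max_right n m')),
      H.comulAt_eq (le_max_left n m') (le_max_right n m')]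
    change (TensorProduct.map LinearMap.id (H.res h : H.A m' →ₗ[R] H.A m)) _ = _
    rw [← LinearMap.comp_apply, ← TensorProduct.map_comp]
    congr 2
    ext b
    exact H.res_res _ _ _⟩
  map_add' a b := Subtype.ext (funext fun m => map_add (H.comulAt n m) a b)
  map_smul' r a := Subtype.ext (funext fun m => map_smul (H.comulAt n m) r a)

theorem rTensor_comulAt {n n' m : ℕ} (h : n ≤ n') (a : H.Fun) :
    (H.res h : H.A n' →ₗ[R] H.A n).rTensor (H.A m) (H.comulAt n' m a) = H.comulAt n m a := by
  rw [H.comulAt_eq (le_max_left n' m) (le_max_right n' m),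
    H.comulAt_eq (h.trans (le_max_left n' m)) (le_max_right n' m), LinearMap.rTensor,
    ← LinearMap.comp_apply, ← TensorProduct.map_comp]
  congr 2
  ext b
  exact H.res_res _ _ _

variable [TopologicalSpace R] [hR : IsPAdicRing p R]

instance (n : ℕ) : IsAdicComplete (ideal p R) (H.A n) :=
  have := hR.isAdicComplete
  isAdicComplete_of_finite_projective _ _

variable {H}

/-- The translation invariant operator `(id ⊗̂ μ) ∘ Δ : 𝒪(H) → 𝒪(H)` attached to a distribution
`μ`, without its topology. -/
def invOpₗ (μ : H.Dist) : H.Fun →ₗ[R] H.Fun where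
  toFun a := ⟨fun n => integral (H.A n) μ (H.coaction n a), fun n n' h => by
    refine (integral_unique _ _ _ _ fun k m f hf => ?_).symm
    have h1 := integral_spec (H.A n') μ (H.coaction n' a) hf
    have h2 := map_smul_top_mem _ (H.res h : H.A n' →ₗ[R] H.A n) h1
    rw [map_sub, ← slice_map] at h2
    have e := H.rTensor_comulAt (m := m) h a
    change slice _ f (LinearMap.rTensor _ _ (H.comulAt n' m a)) - _ ∈ _ at h2
    rw [e] at h2
    exact h2⟩
  map_add' a b := by
    refine Subtype.ext (funext fun n => ?_)
    exact (congrArg (integral (H.A n) μ) (map_add (H.coaction n) a b)).trans (map_add _ _ _)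
  map_smul' r a := by
    refine Subtype.ext (funext fun n => ?_)
    refine (congrArg (integral (H.A n) μ) (map_smul (H.coaction n) r a)).trans ?_
    exact ((integral (H.A n) μ).restrictScalars R).map_smul r _

theorem proj_invOpₗ (μ : H.Dist) (a : H.Fun) (n : ℕ) :
    H.proj n (invOpₗ μ a) = integral (H.A n) μ (H.coaction n a) := rfl

/-- Convolution by a linear form at finite level. -/
def convAt {m : ℕ} (f : H.A m →ₗ[R] R) : H.A m →ₗ[R] H.A m :=
  (slice (H.A m) f).restrictScalars R ∘ₗ Coalgebra.comul

theorem proj_invOpₗ_approx {μ : H.Dist} {k m n : ℕ} {f : H.A m →ₗ[R] R} (hf : Approx μ k m f)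
    (h : n ≤ m) (a : H.Fun) :
    H.res h (convAt f (H.proj m a)) - H.proj n (invOpₗ μ a) ∈
      (ideal p R ^ k • ⊤ : Submodule R (H.A n)) := by
  have h1 := integral_spec (H.A n) μ (H.coaction n a) hf
  have e : H.res h (convAt f (H.proj m a)) = slice (H.A n) f ((H.coaction n a).1 m) := by
    change (H.res h : H.A m →ₗ[R] H.A n) (slice _ f _) = slice _ f (H.comulAt n m a)
    rw [← slice_map, H.comulAt_eq h le_rfl]
    congr 2
    rw [LinearMap.rTensor]
    congr 1
    ext b
    exact (H.res_self _ _).symm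
  rw [e, proj_invOpₗ]
  exact h1

/-- The translation invariant operator `(id ⊗̂ μ) ∘ Δ : 𝒪(H) → 𝒪(H)` attached to a distribution
`μ`, i.e. `(invOp μ a)(x) = ∫ a(x + y) dμ(y)`. When `μ` is a tangent vector at the origin this is
differentiation along the corresponding invariant vector field. -/
def invOp (μ : H.Dist) : H.Fun →L[R] H.Fun where
  toLinearMap := invOpₗ μ
  cont := by
    refine H.continuous_of_nhds_zero _ fun s hs => ?_
    obtain ⟨n, k, hs⟩ := (H.mem_nhds_zero s).1 hs
    obtain ⟨m, f, hf⟩ := exists_approx μ k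
    refine ⟨max m n, k, fun a ha => hs ?_⟩
    have h1 := proj_invOpₗ_approx (hf.res (le_max_left m n)) (le_max_right m n) a
    rw [mem_span_pow_iff (R := R)] at ha
    have h2 := map_smul_top_mem _ ((H.res (le_max_right m n) : H.A (max m n) →ₗ[R] H.A n) ∘ₗ
      convAt (f ∘ₗ (H.res (le_max_left m n) : _ →ₗ[R] _))) ha
    have h3 := sub_mem h2 h1
    change H.proj n (invOpₗ μ a) ∈ Ideal.span {(p : H.A n)} ^ k
    rw [mem_span_pow_iff (R := R)]
    simpa using h3

theorem convAt_convAt {m : ℕ} (f g : H.A m →ₗ[R] R) (x : H.A m) :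
    convAt f (convAt g x) = slice (H.A m)
      ((LinearMap.mul' R R ∘ₗ TensorProduct.map f g) ∘ₗ Coalgebra.comul)
      (Coalgebra.comul (R := R) x) := by
  rw [slice_comp, ← Coalgebra.coassoc_apply]
  change convAt f (slice _ g _) = _
  generalize (Coalgebra.comul (R := R) x) = y
  induction y with
  | zero => simp
  | tmul a b =>
    simp only [slice_tmul, map_smul, LinearMap.rTensor_tmul]
    change g b • slice _ f _ = _
    generalize (Coalgebra.comul (R := R) a) = z
    induction z with
    | zero => simp
    | tmul c d => simp [smul_smul, mul_comm]
    | add x y hx hy => simp only [map_add, smul_add, add_tmul, hx, hy]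
  | add x y hx hy => simp only [map_add, hx, hy]

theorem convAt_comm {m : ℕ} (f g : H.A m →ₗ[R] R) (x : H.A m) :
    convAt f (convAt g x) = convAt g (convAt f x) := by
  rw [convAt_convAt, convAt_convAt]
  congr 2
  rw [← Coalgebra.comm_comp_comul (R := R) (A := H.A m), ← LinearMap.comp_assoc,
    Coalgebra.comm_comp_comul]
  congr 1
  ext a b
  simp [mul_comm]

theorem invOp_comm (μ ν : H.Dist) : invOp μ * invOp ν = invOp ν * invOp μ := by
  have key : ∀ (μ ν : H.Dist) (a : H.Fun) (n k m : ℕ) (f g : H.A m →ₗ[R] R) (h : n ≤ m),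
      Approx μ k m f → Approx ν k m g → H.res h (convAt f (convAt g (H.proj m a))) -
        H.proj n (invOpₗ μ (invOpₗ ν a)) ∈ (ideal p R ^ k • ⊤ : Submodule R (H.A n)) := by
    intro μ ν a n k m f g h hf hg
    have h1 := proj_invOpₗ_approx hf h (invOpₗ ν a)
    have h2 := proj_invOpₗ_approx hg le_rfl a
    have h3 := map_smul_top_mem _ ((H.res h : H.A m →ₗ[R] H.A n) ∘ₗ convAt f) h2
    have h4 := add_mem h3 h1
    rw [H.res_self] at h4
    simpa using h4
  refine ContinuousLinearMap.ext fun a => Fun.ext _ fun n => ?_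
  change H.proj n (invOpₗ μ (invOpₗ ν a)) = H.proj n (invOpₗ ν (invOpₗ μ a))
  rw [← sub_eq_zero]
  refine (inferInstance : IsAdicComplete (ideal p R) (H.A n)).toIsHausdorff.haus' _ fun k => ?_
  rw [SModEq.zero]
  obtain ⟨m, f, hf⟩ := exists_approx μ k
  obtain ⟨m', g, hg⟩ := exists_approx ν k
  have hM : n ≤ max n (max m m') := le_max_left _ _
  have hf' := hf.res ((le_max_left m m').trans (le_max_right n _))
  have hg' := hg.res ((le_max_right m m').trans (le_max_right n _))
  have h1 := key μ ν a n k _ _ _ hM hf' hg'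
  have h2 := key ν μ a n k _ _ _ hM hg' hf'
  rw [convAt_comm] at h2
  have := sub_mem h2 h1
  simpa using this

end Operators
/-! ### The Lie algebra and its symmetric algebra -/

section Lie

variable {p : ℕ} {R : Type u} [CommRing R] (H : PDivisibleGroup.{u, v} p R)

/-- Evaluation of functions on `H` at the origin. -/
def unitSection : H.Fun →ₐ[R] R := (Bialgebra.counitAlgHom R (H.A 0)).comp (H.proj 0)

theorem counit_proj (n : ℕ) (a : H.Fun) :
    Bialgebra.counitAlgHom R (H.A n) (H.proj n a) = H.unitSection a := by
  have h := CoalgHomClass.counit_comp_apply (H.res (Nat.zero_le n)) (H.proj n a)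
  rw [H.res_proj] at h
  exact h.symm

variable [TopologicalSpace R] [IsTopologicalRing R]

/-- `Lie H`, the tangent space of `H` at the origin: the continuous `R`-linear derivations
`𝒪(H) → R` at the origin. -/
def Lie : Submodule R H.Dist where
  carrier := {D | ∀ a b, D (a * b) = H.unitSection a * D b + H.unitSection b * D a}
  add_mem' hD hE a b := by
    simp only [add_apply, hD a b, hE a b]
    ring
  zero_mem' a b := by simp
  smul_mem' r D hD a b := by
    simp only [smul_apply, hD a b, smul_eq_mul]
    ring

variable {H}

theorem Approx.add {μ ν : H.Dist} {k m : ℕ} {f g : H.A m →ₗ[R] R} (hf : Approx μ k m f)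
    (hg : Approx ν k m g) : Approx (μ + ν) k m (f + g) := by
  intro a
  have := add_mem (hf a) (hg a)
  rw [add_apply, LinearMap.add_apply]
  convert this using 1
  ring

theorem Approx.smul {μ : H.Dist} {k m : ℕ} {f : H.A m →ₗ[R] R} (r : R) (hf : Approx μ k m f) :
    Approx (r • μ) k m (r • f) := by
  intro a
  have := Ideal.mul_mem_left _ r (hf a)
  rw [smul_apply, LinearMap.smul_apply]
  convert this using 1
  simp [mul_sub]

variable [hR : IsPAdicRing p R]

/-- To identify `integral C μ x` it is enough to use one approximation of `μ` for each `k`. -/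
theorem integral_eq {C : Type*} [CommRing C] [Algebra R C] [hC : IsAdicComplete (ideal p R) C]
    (μ : H.Dist) (x : H.family C) (c : C)
    (h : ∀ k : ℕ, ∃ m, ∃ f : H.A m →ₗ[R] R, Approx μ k m f ∧
      slice C f (x.1 m) - c ∈ (ideal p R ^ k • ⊤ : Submodule R C)) : integral C μ x = c := by
  rw [← sub_eq_zero]
  refine hC.toIsHausdorff.haus' _ fun k => ?_
  rw [SModEq.zero]
  obtain ⟨m, f, hf, h⟩ := h k
  have := sub_mem h (integral_spec C μ x hf)
  simpa using this

theorem exists_approx₂ (μ ν : H.Dist) (k : ℕ) :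
    ∃ m f g, Approx μ k m f ∧ Approx ν k m g := by
  obtain ⟨m, f, hf⟩ := exists_approx μ k
  obtain ⟨m', g, hg⟩ := exists_approx ν k
  exact ⟨max m m', _, _, hf.res (le_max_left _ _), hg.res (le_max_right _ _)⟩

section Linear
variable {C : Type*} [CommRing C] [Algebra R C] [IsAdicComplete (ideal p R) C]

theorem slice_add {A : Type*} [AddCommGroup A] [Module R A] (f g : A →ₗ[R] R) (x : C ⊗[R] A) :
    slice C (f + g) x = slice C f x + slice C g x := by
  simp [slice, LinearMap.baseChange_add]

theorem slice_smul {A : Type*} [AddCommGroup A] [Module R A] (r : R) (f : A →ₗ[R] R)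
    (x : C ⊗[R] A) : slice C (r • f) x = r • slice C f x := by
  rw [slice, slice, LinearMap.baseChange_smul]
  exact ((AlgebraTensorModule.rid R C C).toLinearMap.restrictScalars R).map_smul r
    (f.baseChange C x)

theorem integral_add (μ ν : H.Dist) (x : H.family C) :
    integral C (μ + ν) x = integral C μ x + integral C ν x := by
  refine integral_eq _ _ _ fun k => ?_
  obtain ⟨m, f, g, hf, hg⟩ := exists_approx₂ μ ν k
  refine ⟨m, f + g, hf.add hg, ?_⟩
  have := add_mem (integral_spec C μ x hf) (integral_spec C ν x hg)
  rw [slice_add]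
  convert this using 1
  ring

theorem integral_smul (r : R) (μ : H.Dist) (x : H.family C) :
    integral C (r • μ) x = r • integral C μ x := by
  refine integral_eq _ _ _ fun k => ?_
  obtain ⟨m, f, hf⟩ := exists_approx μ k
  refine ⟨m, r • f, hf.smul r, ?_⟩
  have := Submodule.smul_mem _ r (integral_spec C μ x hf)
  rwa [slice_smul, ← smul_sub]

end Linear

variable (H)

/-- `invOp` as a linear map in the distribution. -/
def invOpHom : H.Dist →ₗ[R] (H.Fun →L[R] H.Fun) where
  toFun := invOp
  map_add' μ ν := ContinuousLinearMap.ext fun _ => Fun.ext _ fun _ => integral_add μ ν _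
  map_smul' r μ := ContinuousLinearMap.ext fun _ => Fun.ext _ fun _ => integral_smul r μ _

/-- `Sym^• Lie H`. -/
abbrev SymLie : Type (max u v) := SymmetricAlgebra R H.Lie

/-- The commutative algebra of operators on `𝒪(H)` generated by the `invOp μ`. -/
def invOpAlg : Subalgebra R (H.Fun →L[R] H.Fun) := Algebra.adjoin R (Set.range H.invOpHom)

instance : CommRing H.invOpAlg where
  __ := (inferInstance : Ring H.invOpAlg)
  mul_comm := (Algebra.isMulCommutative_adjoin R (s := Set.range H.invOpHom) (by
    rintro _ ⟨μ, rfl⟩ _ ⟨ν, rfl⟩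
    exact invOp_comm μ ν)).is_comm.comm

/-- The action of `Sym^• Lie H` on `𝒪(H)` by invariant differential operators: the extension to an
action of `Sym^• Lie H` of the action of `Lie H` by differentiation along invariant vector
fields. -/
def actFun : H.SymLie →ₐ[R] (H.Fun →L[R] H.Fun) :=
  H.invOpAlg.val.comp (SymmetricAlgebra.lift
    ((H.invOpHom.codRestrict (Subalgebra.toSubmodule H.invOpAlg)
      fun μ => Algebra.subset_adjoin ⟨μ, rfl⟩) ∘ₗ H.Lie.subtype))

theorem actFun_ι (D : H.Lie) : H.actFun (SymmetricAlgebra.ι R H.Lie D) = invOp D.1 := by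
  unfold actFun
  rw [AlgHom.comp_apply, SymmetricAlgebra.lift_ι_apply]
  rfl

/-- The dual action of `Sym^• Lie H` on `𝒪(H)^*`. -/
def actDist : H.SymLie →ₐ[R] Module.End R H.Dist where
  toFun s :=
    { toFun := fun μ => μ.comp (H.actFun s)
      map_add' := fun μ ν => ContinuousLinearMap.add_comp μ ν _
      map_smul' := fun r μ => ContinuousLinearMap.smul_comp r μ _ }
  map_one' := by ext; simp
  map_mul' s t := by ext; rw [mul_comm s t]; simp
  map_zero' := by ext; simp
  map_add' s t := by ext; simp
  commutes' r := by
    ext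
    simp [Algebra.algebraMap_eq_smul_one]

end Lie
/-! ### The Tate module of the dual -/

section Tate

variable {p : ℕ} {R : Type u} [CommRing R] (H : PDivisibleGroup.{u, v} p R)

/-- `𝒪(H[p^n]^D)` for the Cartier dual `H[p^n]^D = Hom(H[p^n], 𝔾_m)`: the `R`-linear dual of
`𝒪(H[p^n])`, multiplied by convolution (dually to the comultiplication of `𝒪(H[p^n])`). -/
def DualA (n : ℕ) : Type (max u v) := WithConv (H.A n →ₗ[R] R)

instance (n : ℕ) : CommRing (H.DualA n) := inferInstanceAs (CommRing (WithConv (H.A n →ₗ[R] R)))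
instance (n : ℕ) : Algebra R (H.DualA n) :=
  inferInstanceAs (Algebra R (WithConv (H.A n →ₗ[R] R)))

/-- The tautological identification of `𝒪(H[p^n]^D)` with the `R`-linear dual of `𝒪(H[p^n])`. -/
def dualEquiv (n : ℕ) : H.DualA n ≃ₗ[R] Module.Dual R (H.A n) :=
  WithConv.linearEquiv R (H.A n →ₗ[R] R)

variable {H} in
theorem DualA.ext {n : ℕ} {f g : H.DualA n} (h : ∀ a, H.dualEquiv n f a = H.dualEquiv n g a) :
    f = g := (H.dualEquiv n).injective (LinearMap.ext h)

theorem dualEquiv_one (n : ℕ) (a : H.A n) :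
    H.dualEquiv n 1 a = Coalgebra.counit (R := R) a := rfl

theorem dualEquiv_mul (n : ℕ) (f g : H.DualA n) (a : H.A n) : H.dualEquiv n (f * g) a =
    LinearMap.mul' R R
      (TensorProduct.map (H.dualEquiv n f) (H.dualEquiv n g) (Coalgebra.comul (R := R) a)) := rfl

/-- Pullback `𝒪(H[p^m]^D) → 𝒪(H[p^n]^D)` along the restriction of characters from `H[p^n]` to
`H[p^m]`. -/
def dualRes {m n : ℕ} (h : m ≤ n) : H.DualA m →ₐ[R] H.DualA n where
  toFun f := (H.dualEquiv n).symm (H.dualEquiv m f ∘ₗ (H.res h : H.A n →ₗ[R] H.A m))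
  map_one' := DualA.ext fun a => CoalgHomClass.counit_comp_apply (H.res h) a
  map_mul' f g := congrArg WithConv.toConv
    (LinearMap.convMul_comp_coalgHom_distrib f g (H.res h : H.A n →ₗc[R] H.A m))
  map_zero' := rfl
  map_add' f g := rfl
  commutes' r := DualA.ext fun a => congrArg (r • ·) (CoalgHomClass.counit_comp_apply (H.res h) a)

theorem dualEquiv_dualRes {m n : ℕ} (h : m ≤ n) (f : H.DualA m) (a : H.A n) :
    H.dualEquiv n (H.dualRes h f) a = H.dualEquiv m f (H.res h a) := rfl

instance : DirectedSystem H.DualA (fun _ _ h => ⇑(H.dualRes h)) where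
  map_self n f := DualA.ext fun a => congrArg (H.dualEquiv n f) (H.res_self n a)
  map_map k j i hij hjk f := DualA.ext fun a => congrArg (H.dualEquiv i f) (H.res_res _ _ a)

/-- `colim_n 𝒪(H[p^n]^D)` -/
abbrev TateColim : Type (max u v) := DirectLimit H.DualA (fun _ _ h => H.dualRes h)

/-- `𝒪(T_p H^∨)`, functions on the Tate module of the dual,
`T_p H^∨ = lim_n H[p^n]^D = Hom(H, 𝔾_m)` over `Spf R`:
the `p`-adic completion of `colim_n 𝒪(H[p^n]^D)`. -/
def Tate : Type (max u v) := AdicCompletion (Ideal.span {(p : H.TateColim)}) H.TateColim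

instance : CommRing H.Tate :=
  inferInstanceAs (CommRing (AdicCompletion (Ideal.span {(p : H.TateColim)}) H.TateColim))
instance : Algebra H.TateColim H.Tate :=
  inferInstanceAs (Algebra H.TateColim
    (AdicCompletion (Ideal.span {(p : H.TateColim)}) H.TateColim))
instance : Algebra R H.Tate :=
  inferInstanceAs (Algebra R (AdicCompletion (Ideal.span {(p : H.TateColim)}) H.TateColim))
instance : IsScalarTower R H.TateColim H.Tate := IsScalarTower.of_algebraMap_eq' rfl

/-- The `p`-adic topology of `𝒪(T_p H^∨)`. -/
instance : TopologicalSpace H.Tate := (Ideal.span {(p : H.Tate)}).adicTopology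

instance : IsTopologicalRing H.Tate :=
  (Ideal.span {(p : H.Tate)}).ringFilterBasis.isTopologicalRing

instance : IsAdicComplete (ideal p R) H.Tate := by
  have h : IsAdicComplete (Ideal.span {(p : H.TateColim)}) H.Tate :=
    AdicCompletion.isAdicComplete (Submodule.fg_span_singleton _)
  have e : Ideal.span {(p : H.TateColim)} = (ideal p R).map (algebraMap R H.TateColim) := by
    simp [Ideal.map_span]
  rw [e] at h
  exact (IsAdicComplete.map_algebraMap_iff _ _).1 h

/-- Pullback of functions along the projection `T_p H^∨ → H[p^n]^D`. -/
def ofDual (n : ℕ) : H.DualA n →ₐ[R] H.Tate :=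
  (IsScalarTower.toAlgHom R H.TateColim H.Tate).comp
    (DirectLimit.Algebra.of H.DualA (fun _ _ h => H.dualRes h) n)

theorem ofDual_dualRes {m n : ℕ} (h : m ≤ n) (f : H.DualA m) :
    H.ofDual n (H.dualRes h f) = H.ofDual m f :=
  congrArg (algebraMap H.TateColim H.Tate) (DirectLimit.Algebra.of_f h f)

/-! ### The universal character -/

/-- The map `A^* ⊗ N → Hom(A, N)` for `A = 𝒪(H[p^n])`. -/
def tensorHom (n : ℕ) (N : Type*) [AddCommGroup N] [Module R N] :
    H.DualA n ⊗[R] N →ₗ[R] (H.A n →ₗ[R] N) :=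
  dualTensorHom R (H.A n) N ∘ₗ (H.dualEquiv n).toLinearMap.rTensor N

theorem tensorHom_tmul (n : ℕ) {N : Type*} [AddCommGroup N] [Module R N] (f : H.DualA n) (x : N)
    (a : H.A n) : H.tensorHom n N (f ⊗ₜ x) a = H.dualEquiv n f a • x := rfl

theorem tensorHom_bijective (n : ℕ) (N : Type*) [AddCommGroup N] [Module R N] :
    Function.Bijective (H.tensorHom n N) :=
  dualTensorHom_bijective.comp
    ((H.dualEquiv n).rTensor N).bijective

/-- The universal character in `𝒪(H[p^n]^D) ⊗ 𝒪(H[p^n])`, the function on `H[p^n]^D × H[p^n]`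
given by the canonical pairing to `𝔾_m ⊆ 𝔸¹`: it is the canonical element of `A^* ⊗ A`. -/
def kappaAt (n : ℕ) : H.DualA n ⊗[R] H.A n :=
  (LinearEquiv.ofBijective _ (H.tensorHom_bijective n (H.A n))).symm LinearMap.id

theorem tensorHom_kappaAt (n : ℕ) : H.tensorHom n (H.A n) (H.kappaAt n) = LinearMap.id :=
  (LinearEquiv.ofBijective _ (H.tensorHom_bijective n (H.A n))).apply_symm_apply _

theorem tensorHom_lTensor (n : ℕ) {N N' : Type*} [AddCommGroup N] [Module R N] [AddCommGroup N']
    [Module R N'] (g : N →ₗ[R] N') (x : H.DualA n ⊗[R] N) :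
    H.tensorHom n N' (g.lTensor _ x) = g ∘ₗ H.tensorHom n N x := by
  induction x with
  | zero => simp
  | tmul f y => ext a; simp [tensorHom_tmul]
  | add x y hx hy => simp only [map_add, hx, hy, LinearMap.comp_add]

theorem tensorHom_rTensor {m n : ℕ} (h : m ≤ n) {N : Type*} [AddCommGroup N] [Module R N]
    (x : H.DualA m ⊗[R] N) :
    H.tensorHom n N ((H.dualRes h).toLinearMap.rTensor N x) =
      H.tensorHom m N x ∘ₗ (H.res h : H.A n →ₗ[R] H.A m) := by
  induction x with
  | zero => simp
  | tmul f y => rfl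
  | add x y hx hy => simp only [map_add, hx, hy, LinearMap.add_comp]

theorem lTensor_kappaAt {m n : ℕ} (h : m ≤ n) :
    (H.res h : H.A n →ₗ[R] H.A m).lTensor (H.DualA n) (H.kappaAt n) =
      (H.dualRes h).toLinearMap.rTensor (H.A m) (H.kappaAt m) := by
  apply (H.tensorHom_bijective n (H.A m)).1
  rw [tensorHom_lTensor, tensorHom_rTensor, tensorHom_kappaAt, tensorHom_kappaAt]
  rfl

/-- Pullback of functions along `T_p H^∨ × H[p^n] → H[p^n]^D × H[p^n]`. -/
def ofDualTensor (n : ℕ) : H.DualA n ⊗[R] H.A n →ₐ[R] H.Tate ⊗[R] H.A n :=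
  Algebra.TensorProduct.map (H.ofDual n) (AlgHom.id R _)

theorem ofDualTensor_compat {m n : ℕ} (h : m ≤ n) (x : H.DualA n ⊗[R] H.A n)
    (y : H.DualA m ⊗[R] H.A m) (hxy : (H.res h : H.A n →ₗ[R] H.A m).lTensor (H.DualA n) x =
      (H.dualRes h).toLinearMap.rTensor (H.A m) y) :
    H.resTensor H.Tate h (H.ofDualTensor n x) = H.ofDualTensor m y := by
  have h1 : ∀ x : H.DualA n ⊗[R] H.A n, H.resTensor H.Tate h (H.ofDualTensor n x) =
      (H.ofDual n).toLinearMap.rTensor (H.A m)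
        ((H.res h : H.A n →ₗ[R] H.A m).lTensor (H.DualA n) x) := by
    intro x
    induction x with
    | zero => simp
    | tmul f a => rfl
    | add x y hx hy => simp only [map_add, hx, hy]
  rw [h1, hxy]
  clear hxy
  induction y with
  | zero => simp
  | tmul f a => exact congrArg (· ⊗ₜ[R] a) (H.ofDual_dualRes h f)
  | add x y hx hy => simp only [map_add, hx, hy]

/-- The universal character `κ ∈ 𝒪(T_p H^∨) ⊗̂ 𝒪(H)`, the canonical pairing
`H × T_p H^∨ → 𝔾_m ⊆ 𝔸¹`. -/
def kappa : H.family H.Tate :=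
  ⟨fun n => H.ofDualTensor n (H.kappaAt n), fun _ _ h =>
    H.ofDualTensor_compat h _ _ (H.lTensor_kappaAt h)⟩

/-- Pullback of `kappaAt n` along the inversion of `H[p^n]`. -/
def kappaInvAt (n : ℕ) : H.DualA n ⊗[R] H.A n :=
  (HopfAlgebra.antipode R (A := H.A n)).lTensor _ (H.kappaAt n)

theorem tensorHom_mul (n : ℕ) (x y : H.DualA n ⊗[R] H.A n) (c : H.A n) :
    H.tensorHom n (H.A n) (x * y) c = LinearMap.mul' R (H.A n)
      (TensorProduct.map (H.tensorHom n (H.A n) x) (H.tensorHom n (H.A n) y)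
        (Coalgebra.comul (R := R) c)) := by
  induction x with
  | zero => simp
  | add x y hx hy =>
    simp only [add_mul, map_add, LinearMap.add_apply, hx, hy, TensorProduct.map_add_left]
  | tmul f a =>
    induction y with
    | zero => simp
    | add x y hx hy =>
      simp only [mul_add, map_add, LinearMap.add_apply, hx, hy, TensorProduct.map_add_right]
    | tmul g b =>
      rw [Algebra.TensorProduct.tmul_mul_tmul, tensorHom_tmul, dualEquiv_mul]
      generalize (Coalgebra.comul (R := R) c) = z
      induction z with
      | zero => simp
      | add x y hx hy => simp only [map_add, add_smul, hx, hy]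
      | tmul c d => simp [tensorHom_tmul, smul_smul, mul_comm]

theorem kappaAt_mul_kappaInvAt (n : ℕ) : H.kappaAt n * H.kappaInvAt n = 1 := by
  apply (H.tensorHom_bijective n (H.A n)).1
  ext c
  rw [tensorHom_mul, kappaInvAt, tensorHom_lTensor, tensorHom_kappaAt, LinearMap.comp_id]
  refine (HopfAlgebra.mul_antipode_lTensor_comul_apply c).trans ?_
  rw [Algebra.algebraMap_eq_smul_one]
  rfl

theorem isUnit_kappa : IsUnit H.kappa := by
  have hunit : ∀ n, H.ofDualTensor n (H.kappaAt n) * H.ofDualTensor n (H.kappaInvAt n) = 1 := by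
    intro n
    rw [← map_mul, kappaAt_mul_kappaInvAt, map_one]
  refine IsUnit.of_mul_eq_one ⟨fun n => H.ofDualTensor n (H.kappaInvAt n), ?_⟩ ?_
  · intro m n h
    beta_reduce
    have h3 := congrArg (H.resTensor H.Tate h) (hunit n)
    rw [map_mul, map_one, H.ofDualTensor_compat h _ _ (H.lTensor_kappaAt h)] at h3
    exact (left_inv_eq_right_inv (by rw [mul_comm]; exact hunit m) h3).symm
  · exact Subtype.ext (funext hunit)

/-- The universal character as an invertible function, i.e. as a morphism to `𝔾_m`. -/
def kappaUnit : (H.family H.Tate)ˣ := H.isUnit_kappa.unit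

end Tate
/-! ### The Hodge–Tate map -/

section HodgeTate

variable {p : ℕ} {R : Type u} [CommRing R] (H : PDivisibleGroup.{u, v} p R)
variable (C : Type*) [CommRing C] [Algebra R C]

/-- The unit section of `H[p^n]`, base changed to `C`. -/
def counitTensor (n : ℕ) : C ⊗[R] H.A n →ₐ[C] C :=
  (Algebra.TensorProduct.rid R C C).toAlgHom.comp
    (Algebra.TensorProduct.map (AlgHom.id C C) (Bialgebra.counitAlgHom R (H.A n)))

theorem counitTensor_tmul (n : ℕ) (c : C) (a : H.A n) :
    H.counitTensor C n (c ⊗ₜ a) = Coalgebra.counit (R := R) a • c := by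
  simp [counitTensor]

/-- Evaluation at the origin for functions on the base change of `H` to `C`. -/
def evalUnit : H.family C →ₐ[C] C :=
  (H.counitTensor C 0).comp ((Pi.evalAlgHom C (fun n => C ⊗[R] H.A n) 0).comp (H.family C).val)

variable {H C}

theorem counitTensor_family (x : H.family C) (n : ℕ) :
    H.counitTensor C n (x.1 n) = evalUnit H C x := by
  change _ = H.counitTensor C 0 (x.1 0)
  rw [← x.2 0 n (Nat.zero_le n)]
  generalize x.1 n = y
  induction y with
  | zero => simp
  | add x y hx hy => simp only [map_add, hx, hy]
  | tmul c a =>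
    change _ = H.counitTensor C 0 (c ⊗ₜ H.res _ a)
    rw [counitTensor_tmul, counitTensor_tmul]
    congr 1
    exact (CoalgHomClass.counit_comp_apply (H.res (Nat.zero_le n)) a).symm

theorem slice_mul_mem (J : Ideal R) {m : ℕ} (f : H.A m →ₗ[R] R)
    (hf : ∀ a b, f (a * b) - (Coalgebra.counit (R := R) a * f b + Coalgebra.counit (R := R) b * f a)
      ∈ J) (x y : C ⊗[R] H.A m) :
    slice C f (x * y) - (H.counitTensor C m x * slice C f y + H.counitTensor C m y * slice C f x) ∈
      (J • ⊤ : Submodule R C) := by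
  induction x with
  | zero => simp
  | add x x' hx hx' =>
    have := add_mem hx hx'
    simp only [add_mul, map_add, mul_add]
    convert this using 1
    ring
  | tmul c a =>
    induction y with
    | zero => simp
    | add y y' hy hy' =>
      have := add_mem hy hy'
      simp only [add_mul, map_add, mul_add]
      convert this using 1
      ring
    | tmul d b =>
      have := Submodule.smul_mem_smul (hf a b) (Submodule.mem_top (x := c * d) (R := R))
      convert this using 1
      simp only [Algebra.TensorProduct.tmul_mul_tmul, slice_tmul, counitTensor_tmul,
        Algebra.smul_def, map_sub, map_add, map_mul]
      ring

variable [TopologicalSpace R] [IsTopologicalRing R] [hR : IsPAdicRing p R]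
variable [IsAdicComplete (ideal p R) C]

theorem integral_mul (D : H.Lie) (x y : H.family C) : integral C D.1 (x * y) =
    evalUnit H C x * integral C D.1 y + evalUnit H C y * integral C D.1 x := by
  refine integral_eq _ _ _ fun k => ?_
  obtain ⟨m, f, hf⟩ := exists_approx D.1 k
  refine ⟨m, f, hf, ?_⟩
  have h1 := slice_mul_mem (C := C) (ideal p R ^ k) f (fun a b => ?_) (x.1 m) (y.1 m)
  · rw [counitTensor_family, counitTensor_family] at h1
    have h2 := integral_spec C D.1 x hf
    have h3 := integral_spec C D.1 y hf
    rw [← mem_span_pow_iff] at h1 h2 h3 ⊢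
    have h4 := add_mem h1 (add_mem (Ideal.mul_mem_left _ (evalUnit H C x) h3)
      (Ideal.mul_mem_left _ (evalUnit H C y) h2))
    convert h4 using 1
    change slice C f (x.1 m * y.1 m) - _ = _
    ring
  · obtain ⟨a, rfl⟩ := H.proj_surjective m a
    obtain ⟨b, rfl⟩ := H.proj_surjective m b
    have h1 := hf (a * b)
    rw [D.2 a b, map_mul] at h1
    have h2 := sub_mem (add_mem (Ideal.mul_mem_left _ (H.unitSection a) (hf b))
      (Ideal.mul_mem_left _ (H.unitSection b) (hf a))) h1
    change _ - (Bialgebra.counitAlgHom R (H.A m) _ * _ + Bialgebra.counitAlgHom R (H.A m) _ * _) ∈ _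
    rw [counit_proj, counit_proj]
    convert h2 using 1
    ring

variable (C)

/-- The pairing `⟨D, ω⟩ ∈ C` of `D ∈ Lie H` with (the value at the origin of) a differential `ω` on
the base change of `H` to `C`: the `C`-linear map with `⟨D, g dh⟩ = g(0) D(h)`. -/
def pairing (D : H.Lie) : Ω[H.family C⁄C] →ₗ[C] C :=
  letI : Module (H.family C) C := Module.compHom C (evalUnit H C).toRingHom
  haveI : IsScalarTower C (H.family C) C := ⟨fun c x d => by
    change evalUnit H C (c • x) * d = c * (evalUnit H C x * d)
    rw [map_smul, smul_eq_mul, mul_assoc]⟩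
  (Derivation.liftKaehlerDifferential
    (Derivation.mk' (integral C D.1) (integral_mul D))).restrictScalars C

theorem pairing_smul_D (D : H.Lie) (g h : H.family C) :
    pairing C D (g • KaehlerDifferential.D C (H.family C) h) =
      evalUnit H C g * integral C D.1 h := by
  let _ : Module (H.family C) C := Module.compHom C (evalUnit H C).toRingHom
  have : IsScalarTower C (H.family C) C := ⟨fun c x d => by
    change evalUnit H C (c • x) * d = c * (evalUnit H C x * d)
    rw [map_smul, smul_eq_mul, mul_assoc]⟩
  change (Derivation.liftKaehlerDifferential
    (Derivation.mk' (integral C D.1) (integral_mul D))) _ = _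
  rw [map_smul, Derivation.liftKaehlerDifferential_comp_D]
  rfl

variable (H)

/-- `κ^*(dt/(1+t)) = κ⁻¹ dκ`, the pullback of the invariant differential `dt/(1+t)` of `𝔾_m` (with
`1 + t` the coordinate of `𝔾_m`) along the universal character over `T_p H^∨`. -/
def kappaDlog : Ω[H.family H.Tate⁄H.Tate] :=
  ((H.kappaUnit⁻¹ : (H.family H.Tate)ˣ) : H.family H.Tate) •
    KaehlerDifferential.D H.Tate (H.family H.Tate) H.kappaUnit

/-- The pullback along the Hodge–Tate map `T_p H^∨ → ω_H`, `f ↦ f^*(dt/(1+t))`, of the linear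
functions on `ω_H`, which are the elements of `Lie H`: the value of `D` on the image of the
universal point `κ` is `⟨D, κ^*(dt/(1+t))⟩`. -/
def hodgeTateLinear : H.Lie →ₗ[R] H.Tate where
  toFun D := pairing H.Tate D H.kappaDlog
  map_add' D E := by
    simp only [kappaDlog, pairing_smul_D, Submodule.coe_add, integral_add, mul_add]
  map_smul' r D := by
    simp only [kappaDlog, pairing_smul_D, Submodule.coe_smul, integral_smul, RingHom.id_apply,
      mul_smul_comm]

/-- Pullback `Sym^• Lie H = 𝒪(ω_H) → 𝒪(T_p H^∨)` along the Hodge–Tate map. -/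
def hodgeTate : H.SymLie →ₐ[R] H.Tate := SymmetricAlgebra.lift H.hodgeTateLinear

end HodgeTate

/-! ### Measures on the Tate module, Fourier transforms -/

section Fourier

variable {p : ℕ} {R : Type u} [CommRing R] (H : PDivisibleGroup.{u, v} p R)
variable [TopologicalSpace R]

/-- `𝒪(T_p H^∨)^*`, the continuous `R`-linear dual of `𝒪(T_p H^∨)`. -/
abbrev Meas : Type (max u v) := H.Tate →L[R] R

variable [IsTopologicalRing R] [hR : IsPAdicRing p R]

/-- The action of `Sym^• Lie H` on `𝒪(T_p H^∨)` by multiplication with functions pulled back along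
the Hodge–Tate map. -/
def actTate : H.SymLie →ₐ[R] Module.End R H.Tate := (Algebra.lmul R H.Tate).comp H.hodgeTate

theorem actTate_apply (s : H.SymLie) (b : H.Tate) : H.actTate s b = H.hodgeTate s * b := rfl

/-- The operators of `actTate` are continuous. -/
def actTateL (s : H.SymLie) : H.Tate →L[R] H.Tate where
  toLinearMap := H.actTate s
  cont := continuous_const.mul continuous_id

/-- The dual action of `Sym^• Lie H` on `𝒪(T_p H^∨)^*`. -/
def actMeas : H.SymLie →ₐ[R] Module.End R H.Meas where
  toFun s :=
    { toFun := fun ν => ν.comp (H.actTateL s)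
      map_add' := fun ν ν' => ContinuousLinearMap.add_comp ν ν' _
      map_smul' := fun r ν => ContinuousLinearMap.smul_comp r ν _ }
  map_one' := by
    refine LinearMap.ext fun ν => ContinuousLinearMap.ext fun b => ?_
    change ν (H.actTate 1 b) = ν b
    rw [map_one]
    rfl
  map_mul' s t := by
    refine LinearMap.ext fun ν => ContinuousLinearMap.ext fun b => ?_
    change ν (H.actTate (s * t) b) = ν (H.actTate t (H.actTate s b))
    rw [mul_comm, map_mul]
    rfl
  map_zero' := by
    refine LinearMap.ext fun ν => ContinuousLinearMap.ext fun b => ?_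
    change ν (H.actTate 0 b) = 0
    rw [map_zero, LinearMap.zero_apply, map_zero]
  map_add' s t := by
    refine LinearMap.ext fun ν => ContinuousLinearMap.ext fun b => ?_
    change ν (H.actTate (s + t) b) = ν (H.actTate s b) + ν (H.actTate t b)
    rw [map_add, LinearMap.add_apply, map_add]
  commutes' r := by
    refine LinearMap.ext fun ν => ContinuousLinearMap.ext fun b => ?_
    change ν (H.actTate (algebraMap R _ r) b) = r • ν b
    rw [AlgHom.commutes, Module.algebraMap_end_apply, map_smul]

/-- The Fourier transform `𝔽^H : 𝒪(H)^* → 𝒪(T_p H^∨)`, `μ ↦ ∫_H κ dμ`. -/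
def fourierDist : H.Dist →ₗ[R] H.Tate where
  toFun μ := integral H.Tate μ H.kappa
  map_add' μ ν := integral_add μ ν _
  map_smul' r μ := integral_smul r μ _

/-- `ν ⊗ id : 𝒪(T_p H^∨) ⊗ 𝒪(H[p^n]) → 𝒪(H[p^n])` for a functional `ν`. -/
def sliceLeft (n : ℕ) : H.Meas →ₗ[R] H.Tate ⊗[R] H.A n →ₗ[R] H.A n :=
  (TensorProduct.lid R (H.A n)).toLinearMap.compRight R ∘ₗ
    (LinearMap.rTensorHom (H.A n) ∘ₗ ContinuousLinearMap.coeLM R)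

theorem sliceLeft_tmul {p : ℕ} {R : Type u} [CommRing R] [TopologicalSpace R]
    [IsTopologicalRing R] (H : PDivisibleGroup.{u, v} p R) (n : ℕ) (ν : H.Meas) (b : H.Tate) (a : H.A n) :
    H.sliceLeft n ν (b ⊗ₜ a) = ν b • a := rfl

/-- The Fourier transform `𝔽_H : 𝒪(T_p H^∨)^* → 𝒪(H)`, `ν ↦ ∫_{T_p H^∨} κ dν`. -/
def fourierMeas : H.Meas →ₗ[R] H.Fun where
  toFun ν := ⟨fun n => H.sliceLeft n ν (H.kappa.1 n), fun m n h => by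
    beta_reduce
    rw [← H.kappa.2 m n h]
    generalize H.kappa.1 n = x
    induction x with
    | zero => simp
    | add x y hx hy => simp only [map_add, hx, hy]
    | tmul b a =>
      rw [sliceLeft_tmul, Algebra.TensorProduct.map_tmul, sliceLeft_tmul]
      exact map_smul (H.res h : H.A n →ₗ[R] H.A m) _ _⟩
  map_add' ν ν' := Fun.ext _ fun n => by
    change H.sliceLeft n (ν + ν') _ = H.sliceLeft n ν _ + H.sliceLeft n ν' _
    rw [map_add, LinearMap.add_apply]
  map_smul' r ν := Fun.ext _ fun n => by
    change H.sliceLeft n (r • ν) _ = r • H.sliceLeft n ν _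
    rw [map_smul, LinearMap.smul_apply]

end Fourier

end PDivisibleGroup

end

namespace PDivisibleGroup

/-! ### The universal character at finite level -/

variable {p : ℕ} {R : Type u} [CommRing R] {H : PDivisibleGroup.{u, v} p R}

/-! The reason is the classical one: a character is an eigenfunction of every translation-invariant
operator, and for a tangent vector the eigenvalue is its logarithmic derivative at the origin, which
is what the Hodge–Tate map records.

At level `n`, put `A = 𝒪(H[p^n])`. Under `A^* ⊗ A ≅ End(A)` the universal character is the identity,
and multiplication in `A^* ⊗ A` becomes convolution of endomorphisms. Two facts follow. Slicing the
character by a linear form `f` returns `f` itself (`slice_kappa`). Applying `(id ⊗ f) ∘ Δ` to the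
`A`-variable of the character multiplies it by `f`, viewed as a function on the Cartier dual
(`lTensor_convAt_kappaAt`). The latter is the identity `κ(x + y) = κ(x) κ(y)` integrated in `y`.

Since `κ` is `1` at the origin, pairing `D` in `Lie H` with `κ⁻¹ dκ` gives `D` applied to `κ`. So
the Hodge–Tate pullback of `D` is the Fourier transform of `D` (`hodgeTateLinear_eq_fourierDist`).

For distributions, the action of `D` on `μ` is convolution with `D`, and the Fourier transform turns
convolution into multiplication (`fourierDist_comp_invOp`). For measures, differentiating `∫ κ dν`
along `D` moves under the integral sign, where it multiplies `κ` by the Hodge–Tate function of `D`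
(`fourierMeas_actMeas_ι`). The passage from `Lie H` to `Sym^• Lie H` is formal, because all four
actions are algebra homomorphisms.

A distribution is only accessible modulo `p^k`, through a linear form at some finite level
(`Approx`). The identities involving distributions are therefore proved modulo every `p^k` from
their finite-level versions, and separatedness concludes. -/

/-- Slicing the universal character by a linear form on `𝒪(H[p^n])` gives that linear form, as a
function on `T_p H^∨`. -/
theorem slice_kappa (n : ℕ) (f : H.A n →ₗ[R] R) :
    slice H.Tate f (H.kappa.1 n) = H.ofDual n ((H.dualEquiv n).symm f) := by
  have h1 : ∀ x : H.DualA n ⊗[R] H.A n, slice H.Tate f (H.ofDualTensor n x) =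
      H.ofDual n ((H.dualEquiv n).symm (f ∘ₗ H.tensorHom n (H.A n) x)) := by
    intro x
    induction x with
    | zero => simp
    | add x y hx hy => simp only [map_add, hx, hy, LinearMap.comp_add]
    | tmul g a =>
      -- On a pure tensor `g ⊗ a` the associated endomorphism is `c ↦ g(c) a`, so composing it with
      -- `f` gives a scalar multiple of `g`.
      have e : (H.dualEquiv n).symm (f ∘ₗ H.tensorHom n (H.A n) (g ⊗ₜ a)) = f a • g := by
        refine DualA.ext fun c => ?_
        rw [LinearEquiv.apply_symm_apply, map_smul, LinearMap.comp_apply, tensorHom_tmul, map_smul,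
          LinearMap.smul_apply, smul_eq_mul, smul_eq_mul, mul_comm]
      rw [e, map_smul]
      exact slice_tmul _ f _ a
  refine (h1 (H.kappaAt n)).trans ?_
  rw [tensorHom_kappaAt, LinearMap.comp_id]

/-- Both sides send `a` to `∑ f(a₁) g(a₂)`. This form lets the product on the Cartier dual be
compared with composition of invariant operators. -/
theorem dualEquiv_symm_mul (n : ℕ) (f g : H.A n →ₗ[R] R) :
    (H.dualEquiv n).symm f * (H.dualEquiv n).symm g =
      (H.dualEquiv n).symm (f ∘ₗ convAt g) := by
  refine DualA.ext fun a => ?_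
  rw [dualEquiv_mul]
  simp only [LinearEquiv.apply_symm_apply]
  change _ = f (slice (H.A n) g (Coalgebra.comul (R := R) a))
  generalize (Coalgebra.comul (R := R) a) = z
  induction z with
  | zero => simp
  | add x y hx hy => simp only [map_add, hx, hy]
  | tmul c d => simp [mul_comm]

/-- Cocommutativity allows `f` to be applied to the left tensor factor instead of the right one. The
result is the convolution of `c ↦ f(c) 1` with the identity, the shape produced by `tensorHom_mul`.
-/
theorem convAt_eq_mul_comul {n : ℕ} (f : H.A n →ₗ[R] R) (c : H.A n) :
    convAt f c = LinearMap.mul' R (H.A n) (TensorProduct.map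
      (LinearMap.toSpanSingleton R (H.A n) 1 ∘ₗ f) LinearMap.id
        (Coalgebra.comul (R := R) c)) := by
  rw [← Coalgebra.comm_comul (R := R) c]
  change slice (H.A n) f (Coalgebra.comul (R := R) c) = _
  generalize (Coalgebra.comul (R := R) c) = z
  induction z with
  | zero => simp
  | add x y hx hy => simp only [map_add, hx, hy]
  | tmul c d => simp

/-- The universal character is an eigenvector of convolution operators. -/
theorem lTensor_convAt_kappaAt (n : ℕ) (f : H.A n →ₗ[R] R) :
    (convAt f).lTensor (H.DualA n) (H.kappaAt n) =
      ((H.dualEquiv n).symm f ⊗ₜ 1) * H.kappaAt n := by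
  -- Compared as endomorphisms of `𝒪(H[p^n])`, the left side is convolution by `f`, and the right
  -- side is the convolution product of `c ↦ f(c) 1` with the identity.
  apply (H.tensorHom_bijective n (H.A n)).1
  refine LinearMap.ext fun c => ?_
  rw [tensorHom_lTensor, tensorHom_mul, tensorHom_kappaAt, LinearMap.comp_id, convAt_eq_mul_comul]
  rfl

/-- Evaluation at the origin is slicing by the counit, and the counit is the unit element of the
convolution algebra. -/
theorem evalUnit_kappa : evalUnit H H.Tate H.kappa = 1 := by
  have h := slice_kappa (H := H) 0 (Coalgebra.counit (R := R))
  refine Eq.trans ?_ (h.trans (map_one (H.ofDual 0)))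
  change H.counitTensor H.Tate 0 (H.kappa.1 0) = _
  generalize H.kappa.1 0 = y
  induction y with
  | zero => simp
  | add x y hx hy => simp only [map_add, hx, hy]
  | tmul c a => rw [counitTensor_tmul, slice_tmul]

/-! ### Integrating the universal character against measures -/

section Topology

variable [TopologicalSpace R] [IsTopologicalRing R]

/-- Integration against `ν` commutes with convolution operators up to multiplication by the
corresponding function on `T_p H^∨`. -/
theorem convAt_sliceLeft_kappa (m : ℕ) (f : H.A m →ₗ[R] R) (ν : H.Meas) :
    convAt f (H.sliceLeft m ν (H.kappa.1 m)) =
      H.sliceLeft m ν ((H.ofDual m ((H.dualEquiv m).symm f) ⊗ₜ 1) * H.kappa.1 m) := by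
  -- The two operations act on different tensor factors, so linearity of convolution suffices to
  -- exchange them.
  have h1 : ∀ x : H.DualA m ⊗[R] H.A m, convAt f (H.sliceLeft m ν (H.ofDualTensor m x)) =
      H.sliceLeft m ν (H.ofDualTensor m ((convAt f).lTensor (H.DualA m) x)) := by
    intro x
    induction x with
    | zero => simp
    | add x y hx hy => simp only [map_add, hx, hy]
    | tmul g a => exact map_smul (convAt f) _ _
  refine (h1 (H.kappaAt m)).trans ?_
  rw [lTensor_convAt_kappaAt, map_mul]
  rfl

/-- A linear functional carries `J`-multiples into `J`. Applied with `J = (p)^k`, this transports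
congruences between functions on the Tate module to congruences between their integrals against `κ`.
-/
theorem sliceLeft_tmul_one_mul_mem (n : ℕ) (ν : H.Meas) (J : Ideal R) {c : H.Tate}
    (hc : c ∈ (J • ⊤ : Submodule R H.Tate)) (x : H.Tate ⊗[R] H.A n) :
    H.sliceLeft n ν ((c ⊗ₜ 1) * x) ∈ (J • ⊤ : Submodule R (H.A n)) := by
  induction x with
  | zero => simp
  | add x y hx hy => rw [mul_add, map_add]; exact add_mem hx hy
  | tmul b a =>
    rw [Algebra.TensorProduct.tmul_mul_tmul, sliceLeft_tmul]
    refine Submodule.smul_mem_smul ?_ trivial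
    have := map_smul_top_mem J (ν.toLinearMap ∘ₗ LinearMap.mulRight R b) hc
    simpa using this

/-! ### Hodge–Tate as a Fourier transform, and the convolution theorem -/

variable [IsPAdicRing p R]

/-- On `Lie H`, pullback along the Hodge–Tate map is the Fourier transform. -/
theorem hodgeTateLinear_eq_fourierDist (D : H.Lie) : H.hodgeTateLinear D = H.fourierDist D.1 := by
  change pairing H.Tate D H.kappaDlog = integral H.Tate D.1 H.kappa
  have h : evalUnit H H.Tate ((H.kappaUnit⁻¹ : (H.family H.Tate)ˣ) : H.family H.Tate) = 1 := by
    -- Evaluation at the origin is a ring homomorphism taking `κ` to `1`, hence also `κ⁻¹` to `1`.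
    have h1 := congrArg (evalUnit H H.Tate) H.kappaUnit.inv_mul
    rw [map_mul, map_one] at h1
    change _ * evalUnit H H.Tate H.kappa = 1 at h1
    rwa [evalUnit_kappa, mul_one] at h1
  rw [kappaDlog, pairing_smul_D, h, one_mul]
  rfl

/-- Two errors occur, from replacing `μ` by `f` and from replacing the operator of `ν` by
convolution with `g`. Both lie in `(p)^k`, the second because `f` is linear, so no precision is
lost. -/
theorem Approx.comp_invOp {μ ν : H.Dist} {k m : ℕ} {f g : H.A m →ₗ[R] R} (hf : Approx μ k m f)
    (hg : Approx ν k m g) : Approx (μ.comp (invOp ν)) k m (f ∘ₗ convAt g) := by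
  intro a
  have h1 := hf (invOp ν a)
  have h2 := proj_invOpₗ_approx hg le_rfl a
  rw [H.res_self] at h2
  have h3 := map_smul_top_mem _ f h2
  rw [map_sub, smul_eq_mul, Ideal.mul_top] at h3
  have h4 := _root_.sub_mem h1 h3
  change μ (invOp ν a) - f (convAt g (H.proj m a)) ∈ _
  convert h4 using 1
  change _ = _ - f (H.proj m (invOpₗ ν a)) - (_ - f (H.proj m (invOpₗ ν a)))
  ring

/-- `ofDual f` agrees with the Fourier transform of `μ` to the precision to which `f` agrees
with `μ`. -/
theorem ofDual_sub_fourierDist_mem {μ : H.Dist} {k m : ℕ} {f : H.A m →ₗ[R] R}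
    (hf : Approx μ k m f) : H.ofDual m ((H.dualEquiv m).symm f) - H.fourierDist μ ∈
      (ideal p R ^ k • ⊤ : Submodule R H.Tate) := by
  rw [← slice_kappa]
  exact integral_spec H.Tate μ H.kappa hf

/-- The Fourier transform takes convolution of distributions to multiplication of functions. -/
theorem fourierDist_comp_invOp (μ ν : H.Dist) :
    H.fourierDist (μ.comp (invOp ν)) = H.fourierDist μ * H.fourierDist ν := by
  refine integral_eq _ _ _ fun k => ?_
  obtain ⟨m, f, g, hf, hg⟩ := exists_approx₂ μ ν k
  refine ⟨m, f ∘ₗ convAt g, hf.comp_invOp hg, ?_⟩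
  have h1 := ofDual_sub_fourierDist_mem hf
  have h2 := ofDual_sub_fourierDist_mem hg
  rw [slice_kappa, ← dualEquiv_symm_mul, map_mul]
  -- Reading `p^k • ⊤` as an ideal power of `𝒪(T_p H^∨)` makes it stable under multiplication by
  -- arbitrary functions. The product error then splits as `F G - F' G' = (F - F') G + F' (G - G')`.
  rw [← mem_span_pow_iff] at h1 h2 ⊢
  have h3 := add_mem (Ideal.mul_mem_right (H.ofDual m ((H.dualEquiv m).symm g)) _ h1)
    (Ideal.mul_mem_left _ (H.fourierDist μ) h2)
  convert h3 using 1
  ring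

/-! ### Equivariance on distributions -/

theorem actTate_ι (D : H.Lie) (b : H.Tate) :
    H.actTate (SymmetricAlgebra.ι R H.Lie D) b = H.fourierDist D.1 * b := by
  rw [actTate_apply, hodgeTate, SymmetricAlgebra.lift_ι_apply, hodgeTateLinear_eq_fourierDist]

theorem fourierDist_actDist (s : H.SymLie) (μ : H.Dist) :
    H.fourierDist (H.actDist s μ) = H.actTate s (H.fourierDist μ) := by
  -- `μ` must vary: for a product `s t`, the hypothesis for `s` is applied to the distribution `t ·
  -- μ`.
  induction s using SymmetricAlgebra.induction generalizing μ with
  | algebraMap r => simp only [AlgHom.commutes, Module.algebraMap_end_apply, map_smul]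
  | ι D =>
    rw [actTate_ι, mul_comm, ← fourierDist_comp_invOp, ← actFun_ι]
    rfl
  | mul s t hs ht => simp only [map_mul, Module.End.mul_apply, hs, ht]
  | add s t hs ht => simp only [map_add, LinearMap.add_apply, hs, ht]

/-! ### Equivariance on measures -/

theorem sliceLeft_comp_actTateL (n : ℕ) (ν : H.Meas) (s : H.SymLie) (x : H.Tate ⊗[R] H.A n) :
    H.sliceLeft n (ν.comp (H.actTateL s)) x =
      H.sliceLeft n ν ((H.hodgeTate s ⊗ₜ 1) * x) := by
  induction x with
  | zero => simp
  | add x y hx hy => simp only [mul_add, map_add, hx, hy]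
  | tmul b a =>
    rw [Algebra.TensorProduct.tmul_mul_tmul, sliceLeft_tmul, sliceLeft_tmul, one_mul]
    rfl

/-- Differentiation under the integral sign: at a level where `D` is approximated by `f`,
convolution by `f` passes inside the integral against `ν` and multiplies `κ` by `f`, which is
congruent to the Hodge–Tate function of `D`. -/
theorem fourierMeas_actMeas_ι (D : H.Lie) (ν : H.Meas) :
    H.fourierMeas (H.actMeas (SymmetricAlgebra.ι R H.Lie D) ν) =
      invOp D.1 (H.fourierMeas ν) := by
  refine Fun.ext _ fun n => ?_
  rw [← sub_eq_zero]
  refine (inferInstance : IsAdicComplete (ideal p R) (H.A n)).toIsHausdorff.haus' _ fun k => ?_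
  rw [SModEq.zero]
  obtain ⟨m₀, f₀, hf₀⟩ := exists_approx D.1 k
  -- The comparison is made at a level `m ≥ n` and then restricted to level `n`, so the
  -- approximating form is first pulled back to such a level.
  obtain ⟨m, hnm, f, hf⟩ : ∃ m, n ≤ m ∧ ∃ f, Approx D.1 k m f :=
    ⟨_, le_max_right m₀ n, _, hf₀.res (le_max_left m₀ n)⟩
  have h1 := proj_invOpₗ_approx hf hnm (H.fourierMeas ν)
  have h2 := sliceLeft_tmul_one_mul_mem m ν _ (ofDual_sub_fourierDist_mem hf) (H.kappa.1 m)
  rw [sub_tmul, sub_mul, map_sub, ← convAt_sliceLeft_kappa, ← hodgeTateLinear_eq_fourierDist,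
    ← SymmetricAlgebra.lift_ι_apply (f := H.hodgeTateLinear)] at h2
  change _ - H.sliceLeft m ν ((H.hodgeTate (SymmetricAlgebra.ι R H.Lie D) ⊗ₜ 1) * _) ∈ _ at h2
  rw [← sliceLeft_comp_actTateL] at h2
  have h3 := map_smul_top_mem _ (H.res hnm : H.A m →ₗ[R] H.A n) h2
  rw [map_sub] at h3
  -- Both differences start with the restricted convolution of the Fourier transform by `f`. It
  -- cancels, leaving the difference of the two sides of the claim.
  have h4 := sub_mem h1 h3
  have e : H.proj n (H.fourierMeas (H.actMeas (SymmetricAlgebra.ι R H.Lie D) ν)) =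
      H.res hnm (H.sliceLeft m (ν.comp (H.actTateL (SymmetricAlgebra.ι R H.Lie D)))
        (H.kappa.1 m)) :=
    (H.res_proj hnm (H.fourierMeas (ν.comp (H.actTateL (SymmetricAlgebra.ι R H.Lie D))))).symm
  rw [e]
  refine (congrArg (· ∈ (ideal p R ^ k • ⊤ : Submodule R (H.A n))) ?_).mp h4
  exact sub_sub_sub_cancel_left _ _ _

theorem fourierMeas_actMeas (s : H.SymLie) (ν : H.Meas) :
    H.fourierMeas (H.actMeas s ν) = H.actFun s (H.fourierMeas ν) := by
  induction s using SymmetricAlgebra.induction generalizing ν with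
  | algebraMap r =>
    simp only [AlgHom.commutes, Module.algebraMap_end_apply, map_smul]
    simp [Algebra.algebraMap_eq_smul_one]
  | ι D => rw [fourierMeas_actMeas_ι, actFun_ι]
  | mul s t hs ht => simp only [map_mul, Module.End.mul_apply, hs, ht]; rfl
  | add s t hs ht => simp only [map_add, LinearMap.add_apply, hs, ht]; rfl

end Topology

end PDivisibleGroup

theorem mainTheorem5 {p : ℕ} [Fact p.Prime] {R : Type u} [CommRing R] [TopologicalSpace R]
    [IsTopologicalRing R] [IsPAdicRing p R] (H : PDivisibleGroup.{u, v} p R) :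
    (∀ (s : H.SymLie) (μ : H.Dist),
      H.fourierDist (H.actDist s μ) = H.actTate s (H.fourierDist μ)) ∧
    (∀ (s : H.SymLie) (ν : H.Meas),
      H.fourierMeas (H.actMeas s ν) = H.actFun s (H.fourierMeas ν)) :=
  ⟨PDivisibleGroup.fourierDist_actDist, PDivisibleGroup.fourierMeas_actMeas⟩
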